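/- Let $A\in\mathbb{R}^{n\times n}$ and let $\Delta=\{p\in\mathbb{R}^n: p_i\ge 0,\ \sum_i p_i=1\}$. For $T>0$ and $p\in\mathbb{R}^n$ let $$\widetilde W(p;T)=\int_0^T e^{At}\,\mathrm{diag}(p)\,e^{A^\top t}\,dt .$$ The finite-horizon AECS problem with horizon $T$ is to minimize $\mathrm{tr}\big(\widetilde W(p;T)^{-1}\big)$ over all $p\in\Delta$ with $\widetilde W(p;T)\succ 0$ (positive definite). Let $Q^{-1}AQ=\begin{pmatrix}J_-&0\\0&J'\end{pmatrix}$ be a Jordan decomposition of $A$ over $\mathbb{C}$, where $J_-$ consists of the Jordan blocks whose eigenvalues have negative real part and $J'$ of all the other Jordan blocks. For $p\in\mathbb{R}^n$ let $W_-(p)$ be the unique solution of the Lyapunov equation $$J_-W_-(p)+W_-(p)J_-^*+\big(Q^{-1}\mathrm{diag}(p)Q^{-*}\big)_{-,-}=0,$$ where $(\cdot)_{-,-}$ denotes the upper left block of the same size as $J_-$. The infinite-horizon AECS problem is to minimize $$\mathrm{tr}\left(Q^{-*}\begin{pmatrix}W_-(p)^{-1}&0\\0&0\end{pmatrix}Q^{-1}\right)$$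 over all $p\in\Delta$ with $W_-(p)\succ 0$. **Theorem.** Assume that $A$ has at least one eigenvalue with negative real part, and that the infinite-horizon AECS problem has a unique optimal solution $p^\infty_{\mathrm{AECS}}$. Then for every $T>0$ the finite-horizon AECS problem with horizon $T$ has an optimal solution, and for every choice of optimal solutions $p^T_{\mathrm{AECS}}$ of these problems ($T>0$), $$p^T_{\mathrm{AECS}}\to p^\infty_{\mathrm{AECS}}\qquad\text{as } T\to\infty .$$ -/

import Mathlib

open Filter Topology

noncomputable section

open scoped ComplexOrder

namespace ControllabilityScore

/-- The Jordan block `μ I_k + N_k`, with ones on the superdiagonal. -/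
def jordanBlock (μ : ℂ) (k : ℕ) : Matrix (Fin k) (Fin k) ℂ :=
  Matrix.of fun a b => if a = b then μ else if (a : ℕ) + 1 = (b : ℕ) then 1 else 0

/-- The block-diagonal Jordan matrix with `m` blocks; the `i`-th block has eigenvalue `eig i`
and size `size i`. Rows and columns are labelled by (block, position inside the block). -/
def jordanMatrix {m : ℕ} (size : Fin m → ℕ) (eig : Fin m → ℂ) :
    Matrix (Σ i, Fin (size i)) (Σ i, Fin (size i)) ℂ :=
  Matrix.blockDiagonal' fun i => jordanBlock (eig i) (size i)

/-- A Jordan decomposition `Q⁻¹ A Q = diag(J₋, J')` over `ℂ` of a real square matrix `A`, in which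
the Jordan blocks whose eigenvalues have negative real part (forming `J₋`) come first and the
remaining Jordan blocks (forming `J'`) come last. -/
structure JordanDecomposition {n : ℕ} (A : Matrix (Fin n) (Fin n) ℝ) where
  /-- number of Jordan blocks whose eigenvalue has negative real part -/
  mStable : ℕ
  /-- number of the other Jordan blocks -/
  mOther : ℕ
  sizeStable : Fin mStable → ℕ
  sizeOther : Fin mOther → ℕ
  eigStable : Fin mStable → ℂ
  eigOther : Fin mOther → ℂ
  sizeStable_pos : ∀ i, 0 < sizeStable i
  sizeOther_pos : ∀ i, 0 < sizeOther i
  eigStable_re : ∀ i, (eigStable i).re < 0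
  eigOther_re : ∀ i, 0 ≤ (eigOther i).re
  /-- the transformation matrix `Q` -/
  Q : Matrix (Fin n) ((Σ i, Fin (sizeStable i)) ⊕ (Σ i, Fin (sizeOther i))) ℂ
  /-- the inverse `Q⁻¹` of `Q` -/
  Qinv : Matrix ((Σ i, Fin (sizeStable i)) ⊕ (Σ i, Fin (sizeOther i))) (Fin n) ℂ
  Q_mul_Qinv : Q * Qinv = 1
  Qinv_mul_Q : Qinv * Q = 1
  Qinv_mul_A_mul_Q : Qinv * A.map Complex.ofReal * Q =
    Matrix.fromBlocks (jordanMatrix sizeStable eigStable) 0 0 (jordanMatrix sizeOther eigOther)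

/-- The Lyapunov equation of a Jordan matrix whose eigenvalues have negative real parts has exactly
one solution. -/
theorem existsUnique_lyapunov {m : ℕ} (size : Fin m → ℕ) (eig : Fin m → ℂ)
    (heig : ∀ i, (eig i).re < 0) (P : Matrix (Σ i, Fin (size i)) (Σ i, Fin (size i)) ℂ) :
    ∃! Y : Matrix (Σ i, Fin (size i)) (Σ i, Fin (size i)) ℂ,
      jordanMatrix size eig * Y + Y * (jordanMatrix size eig).conjTranspose + P = 0 := by
  classical
  set J := jordanMatrix size eig with hJ
  let L : Matrix (Σ i, Fin (size i)) (Σ i, Fin (size i)) ℂ →ₗ[ℂ]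
      Matrix (Σ i, Fin (size i)) (Σ i, Fin (size i)) ℂ :=
    { toFun := fun Y => J * Y + Y * J.conjTranspose
      map_add' := fun X Y => by rw [Matrix.mul_add, Matrix.add_mul]; abel
      map_smul' := fun c X => by simp [smul_add] }
  have hLdef : ∀ Y, L Y = J * Y + Y * J.conjTranspose := fun _ => rfl
  have hdiag : ∀ x, J x x = eig x.1 := by
    rintro ⟨i, a⟩
    simp [hJ, jordanMatrix, jordanBlock, Matrix.blockDiagonal'_apply]
  have hoff : ∀ x z, z ≠ x → J x z ≠ 0 →
      size z.1 - (z.2 : ℕ) < size x.1 - (x.2 : ℕ) := by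
    rintro ⟨i, a⟩ ⟨j, b⟩ hne hnz
    by_cases hij : i = j
    · subst hij
      have hab : a ≠ b := fun h => hne (by rw [h])
      simp only [hJ, jordanMatrix, jordanBlock, Matrix.blockDiagonal'_apply_eq, Matrix.of_apply,
        if_neg hab] at hnz
      have h1 : (a : ℕ) + 1 = b := by
        by_contra h
        exact hnz (if_neg h)
      have h2 := b.isLt
      show size i - (b : ℕ) < size i - (a : ℕ)
      omega
    · exact absurd (Matrix.blockDiagonal'_apply_ne _ _ _ hij) hnz
  have hinj : Function.Injective L := by
    rw [← LinearMap.ker_eq_bot, LinearMap.ker_eq_bot']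
    intro Y hY
    have key : ∀ (k : ℕ) (x y : Σ i, Fin (size i)),
        (size x.1 - (x.2 : ℕ)) + (size y.1 - (y.2 : ℕ)) = k → Y x y = 0 := by
      intro k
      induction k using Nat.strong_induction_on with
      | _ k ih =>
        intro x y hk
        have e : (J * Y) x y + (Y * J.conjTranspose) x y = 0 := by
          have := congrFun (congrFun hY x) y
          simpa [hLdef] using this
        have e1 : (J * Y) x y = eig x.1 * Y x y := by
          rw [Matrix.mul_apply, Finset.sum_eq_single x, hdiag]
          · intro z _ hz
            by_cases h : J x z = 0
            · rw [h, zero_mul]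
            · rw [ih _ (by have := hoff x z hz h; omega) z y rfl, mul_zero]
          · simp
        have e2 : (Y * J.conjTranspose) x y = Y x y * star (eig y.1) := by
          rw [Matrix.mul_apply, Finset.sum_eq_single y, Matrix.conjTranspose_apply, hdiag]
          · intro z _ hz
            by_cases h : J y z = 0
            · rw [Matrix.conjTranspose_apply, h, star_zero, mul_zero]
            · rw [ih _ (by have := hoff y z hz h; omega) x z rfl, zero_mul]
          · simp
        rw [e1, e2, mul_comm (Y x y), ← add_mul] at e
        rcases mul_eq_zero.mp e with h | h
        · exfalso
          have h3 := congrArg Complex.re h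
          simp only [Complex.star_def, Complex.add_re, Complex.conj_re, Complex.zero_re] at h3
          linarith [heig x.1, heig y.1]
        · exact h
    ext x y
    exact key _ x y rfl
  have hsurj : Function.Surjective L := LinearMap.injective_iff_surjective.mp hinj
  obtain ⟨Y, hY⟩ := hsurj (-P)
  refine ⟨Y, ?_, ?_⟩
  · show L Y + P = 0
    rw [hY]; simp
  · intro Z hZ
    apply hinj
    rw [hY]
    exact eq_neg_of_add_eq_zero_left hZ

namespace JordanDecomposition

variable {n : ℕ} {A : Matrix (Fin n) (Fin n) ℝ}

/-- `J₋`, the Jordan matrix of the eigenvalues with negative real parts. -/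
def JStable (d : JordanDecomposition A) :
    Matrix (Σ i, Fin (d.sizeStable i)) (Σ i, Fin (d.sizeStable i)) ℂ :=
  jordanMatrix d.sizeStable d.eigStable

/-- The upper left block of `Q⁻¹ B Q⁻*`. -/
def BStable (d : JordanDecomposition A) (B : Matrix (Fin n) (Fin n) ℂ) :
    Matrix (Σ i, Fin (d.sizeStable i)) (Σ i, Fin (d.sizeStable i)) ℂ :=
  (d.Qinv * B * d.Qinv.conjTranspose).toBlocks₁₁

/-- `W₋(B)`, the unique solution of `J₋ W + W J₋* + (Q⁻¹ B Q⁻*)₋₋ = 0`. -/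
def WStable (d : JordanDecomposition A) (B : Matrix (Fin n) (Fin n) ℂ) :
    Matrix (Σ i, Fin (d.sizeStable i)) (Σ i, Fin (d.sizeStable i)) ℂ :=
  (existsUnique_lyapunov d.sizeStable d.eigStable d.eigStable_re (d.BStable B)).choose

theorem WStable_spec (d : JordanDecomposition A) (B : Matrix (Fin n) (Fin n) ℂ) :
    d.JStable * d.WStable B + d.WStable B * d.JStable.conjTranspose + d.BStable B = 0 :=
  (existsUnique_lyapunov d.sizeStable d.eigStable d.eigStable_re (d.BStable B)).choose_spec.1

/-- `W₋(p) = W₋(diag(p))`. -/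
def WStableVec (d : JordanDecomposition A) (p : Fin n → ℝ) :
    Matrix (Σ i, Fin (d.sizeStable i)) (Σ i, Fin (d.sizeStable i)) ℂ :=
  d.WStable (Matrix.diagonal fun i => (p i : ℂ))

/-- The feasible set of the infinite-horizon problem: `p ∈ Δ` and `W₋(p) ≻ 0`. -/
def infiniteFeasible (d : JordanDecomposition A) : Set (Fin n → ℝ) :=
  {p | p ∈ stdSimplex ℝ (Fin n) ∧ (d.WStableVec p).PosDef}

/-- The objective `tr (Q⁻* diag(W₋(p)⁻¹, 0) Q⁻¹)` of the infinite-horizon problem. The matrix is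
Hermitian at every feasible `p`, so there its trace is a real number; `re` only changes the type. -/
def infiniteObjective (d : JordanDecomposition A) (p : Fin n → ℝ) : ℝ :=
  Complex.re <| Matrix.trace <|
    d.Qinv.conjTranspose *
      (Matrix.fromBlocks (d.WStableVec p)⁻¹ 0 0 0 :
        Matrix ((Σ i, Fin (d.sizeStable i)) ⊕ (Σ i, Fin (d.sizeOther i)))
          ((Σ i, Fin (d.sizeStable i)) ⊕ (Σ i, Fin (d.sizeOther i))) ℂ) *
      d.Qinv

/-- `p` is an optimal solution of the infinite-horizon AECS problem. -/
def IsInfiniteAECS (d : JordanDecomposition A) (p : Fin n → ℝ) : Prop :=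
  p ∈ d.infiniteFeasible ∧ ∀ q ∈ d.infiniteFeasible, d.infiniteObjective p ≤ d.infiniteObjective q

end JordanDecomposition

/-- The controllability Gramian `∫₀ᵀ exp(tA) diag(p) exp(tAᵀ) dt`, integrated entrywise. -/
def gramian {n : ℕ} (A : Matrix (Fin n) (Fin n) ℝ) (p : Fin n → ℝ) (T : ℝ) :
    Matrix (Fin n) (Fin n) ℝ :=
  Matrix.of fun i j => ∫ t in (0 : ℝ)..T,
    (NormedSpace.exp (t • A) * Matrix.diagonal p * NormedSpace.exp (t • A.transpose)) i j

/-- The feasible set of the problem with horizon `T`: `p ∈ Δ` and the Gramian is positive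
definite. -/
def finiteFeasible {n : ℕ} (A : Matrix (Fin n) (Fin n) ℝ) (T : ℝ) : Set (Fin n → ℝ) :=
  {p | p ∈ stdSimplex ℝ (Fin n) ∧ (gramian A p T).PosDef}

/-- `p` is an optimal solution of the AECS problem with horizon `T`, whose objective is the trace of
the inverse of the Gramian. -/
def IsFiniteAECS {n : ℕ} (A : Matrix (Fin n) (Fin n) ℝ) (T : ℝ) (p : Fin n → ℝ) : Prop :=
  p ∈ finiteFeasible A T ∧
    ∀ q ∈ finiteFeasible A T, ((gramian A p T)⁻¹).trace ≤ ((gramian A q T)⁻¹).trace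

end ControllabilityScore

end

/-! In Jordan coordinates the Gramian `G_T = Q⁻¹ W̃ Q⁻*` increases with `T` and solves `G' = J G + G
J* + P`. Its stable block increases to `W₋(p)`, and this gives `G_T⁻¹ ≥ diag(W₋(p)⁻¹, 0)`: the
finite objective dominates the infinite one (`posSemidef_inv_congruence_gramian_sub`,
`infiniteObjective_le`).

For `p` with positive entries the bound is attained in the limit (`tendsto_inv_congruence_gramian`):
`G_T⁻¹` decreases to a solution of an algebraic Riccati equation, which must vanish outside the
stable block.

Uniform convergence in `p` is not needed. With `q` positive and nearly optimal for the infinite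
problem, and `F_T`, `F` the finite and infinite objectives, `F(pInf) ≤ F(p_T) ≤ F_T(p_T) ≤ F_T(q) →
F(q)`. Hence the finite optima form a minimizing family for `F`, and compactness together with
uniqueness of the minimizer gives convergence (`tendsto_of_tendsto_infiniteObjective`). -/

namespace ControllabilityScore

/-! ### Positive semidefinite matrices, Loewner order and inversion -/

section MatrixLemmas

open scoped ComplexOrder Matrix Matrix.Norms.Operator

variable {𝕜 ι : Type*} [RCLike 𝕜] [Fintype ι]

/-- Write `M` as a sum of rank-one terms `v v*` and apply weighted AM-GM to `‖v i‖ ‖v j‖`. The free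
weight `r` later lets an off-diagonal term be absorbed by the damping of a stable eigenvalue. -/
theorem two_mul_norm_apply_le {M : Matrix ι ι 𝕜} (hM : M.PosSemidef) {r : ℝ} (hr : 0 < r)
    (i j : ι) : 2 * ‖M i j‖ ≤ r * RCLike.re (M i i) + r⁻¹ * RCLike.re (M j j) := by
  obtain ⟨m, v, rfl⟩ := Matrix.posSemidef_iff_eq_sum_vecMulVec.mp hM
  have hd : ∀ i, RCLike.re ((∑ k, Matrix.vecMulVec (v k) (star (v k))) i i)
      = ∑ k, ‖v k i‖ ^ 2 := by
    intro i
    simp only [Matrix.sum_apply, Matrix.vecMulVec_apply, Pi.star_apply, map_sum]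
    refine Finset.sum_congr rfl fun k _ => ?_
    rw [RCLike.star_def, RCLike.mul_conj]
    norm_cast
  rw [hd, hd, Finset.mul_sum, Finset.mul_sum, ← Finset.sum_add_distrib]
  simp only [Matrix.sum_apply, Matrix.vecMulVec_apply, Pi.star_apply]
  refine (mul_le_mul_of_nonneg_left (norm_sum_le _ _) zero_le_two).trans ?_
  rw [Finset.mul_sum]
  refine Finset.sum_le_sum fun k _ => ?_
  rw [norm_mul, norm_star]
  have h : 0 ≤ r⁻¹ * (r * ‖v k i‖ - ‖v k j‖) ^ 2 := by positivity
  have h2 : r⁻¹ * (r * ‖v k i‖ - ‖v k j‖) ^ 2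
      = r * ‖v k i‖ ^ 2 + r⁻¹ * ‖v k j‖ ^ 2 - 2 * (‖v k i‖ * ‖v k j‖) := by
    field_simp
    ring
  linarith

theorem re_apply_nonneg {n : Type*} {M : Matrix n n 𝕜} (hM : M.PosSemidef) (i : n) :
    0 ≤ RCLike.re (M i i) := (RCLike.nonneg_iff.mp hM.diag_nonneg).1

theorem re_apply_le_re_trace {M : Matrix ι ι 𝕜} (hM : M.PosSemidef) (i : ι) :
    RCLike.re (M i i) ≤ RCLike.re M.trace := by
  rw [Matrix.trace, map_sum]
  exact Finset.single_le_sum (f := fun i => RCLike.re (M.diag i))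
    (fun k _ => re_apply_nonneg hM k) (Finset.mem_univ i)

theorem norm_apply_le_re_trace {M : Matrix ι ι 𝕜} (hM : M.PosSemidef) (i j : ι) :
    ‖M i j‖ ≤ RCLike.re M.trace := by
  have h := two_mul_norm_apply_le hM one_pos i j
  have hi := re_apply_le_re_trace hM i
  have hj := re_apply_le_re_trace hM j
  norm_num at h
  linarith

theorem isClosed_posSemidef : IsClosed {M : Matrix ι ι 𝕜 | M.PosSemidef} := by
  have h : {M : Matrix ι ι 𝕜 | M.PosSemidef} = {M | Mᴴ = M} ∩
      ⋂ x : ι → 𝕜, {M | 0 ≤ star x ⬝ᵥ (M *ᵥ x)} := by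
    ext M
    simp only [Set.mem_inter_iff, Set.mem_iInter, Set.mem_ofPred_eq]
    exact Matrix.posSemidef_iff_dotProduct_mulVec
  rw [h]
  refine (isClosed_eq (continuous_id.matrix_conjTranspose) continuous_id).inter
    (isClosed_iInter fun x => ?_)
  exact isClosed_le continuous_const
    (continuous_const.dotProduct (continuous_id.matrix_mulVec continuous_const))

theorem isCompact_posSemidef_trace_le (c : ℝ) :
    IsCompact {M : Matrix ι ι 𝕜 | M.PosSemidef ∧ RCLike.re M.trace ≤ c} := by
  have hK : IsCompact {M : Matrix ι ι 𝕜 | ∀ i j, M i j ∈ Metric.closedBall (0 : 𝕜) c} :=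
    (isCompact_closedBall (0 : 𝕜) c).matrix
  refine hK.of_isClosed_subset (isClosed_posSemidef.inter ?_) ?_
  · exact isClosed_le (RCLike.continuous_re.comp continuous_id.matrix_trace) continuous_const
  · rintro M ⟨hM, hc⟩ i j
    rw [mem_closedBall_zero_iff]
    exact (norm_apply_le_re_trace hM i j).trans hc

/-- A family of matrices that is monotone in the Loewner order and whose traces are bounded above
converges. -/
theorem exists_tendsto_of_posSemidef_sub {M : ℝ → Matrix ι ι 𝕜} {c : ℝ}
    (hmono : ∀ s t, 0 < s → s ≤ t → (M t - M s).PosSemidef)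
    (hbdd : ∀ t, 0 < t → RCLike.re (M t).trace ≤ c) :
    ∃ L, Tendsto M atTop (𝓝 L) := by
  have htr : ∀ s t, 0 < s → s ≤ t → RCLike.re (M s).trace ≤ RCLike.re (M t).trace := by
    intro s t hs hst
    have := (RCLike.nonneg_iff.mp (hmono s t hs hst).trace_nonneg).1
    rw [Matrix.trace_sub, map_sub] at this
    linarith
  -- Monotonicity is only assumed at positive times, so the argument is truncated below at 1.
  let f : ℝ → ℝ := fun t => RCLike.re (M (max t 1)).trace
  have hf : Monotone f := fun s t hst =>
    htr _ _ (lt_max_of_lt_right one_pos) (max_le_max_right 1 hst)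
  have hfb : BddAbove (Set.range f) :=
    ⟨c, by rintro _ ⟨t, rfl⟩; exact hbdd _ (lt_max_of_lt_right one_pos)⟩
  have hfc : CauchySeq f := (tendsto_atTop_ciSup hf hfb).cauchySeq
  have hentry : ∀ i j, ∃ l, Tendsto (fun t => M t i j) atTop (𝓝 l) := by
    intro i j
    apply cauchySeq_tendsto_of_complete
    rw [Metric.cauchySeq_iff'] at hfc ⊢
    intro ε hε
    obtain ⟨N, hN⟩ := hfc ε hε
    refine ⟨max N 1, fun t ht => ?_⟩
    -- The increment is positive semidefinite, so its trace bounds each entry: the Cauchy property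
    -- passes from the traces to the entries.
    have hd := norm_apply_le_re_trace
      (hmono (max N 1) t (lt_max_of_lt_right one_pos) ht) i j
    have h1 := hN t ((le_max_left _ _).trans ht)
    have h2 : max t 1 = t := max_eq_left ((le_max_right _ _).trans ht)
    simp only [f, h2] at h1
    rw [dist_eq_norm, ← Matrix.sub_apply]
    rw [Matrix.trace_sub, map_sub] at hd
    exact hd.trans_lt ((le_abs_self _).trans_lt h1)
  choose l hl using hentry
  exact ⟨Matrix.of l, tendsto_pi_nhds.mpr fun i => tendsto_pi_nhds.mpr fun j => hl i j⟩

/-- If a function and its derivative both converge at infinity, then the limit of the derivative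
is zero. -/
theorem eq_zero_of_tendsto_of_tendsto_deriv {E : Type*} [NormedAddCommGroup E] [NormedSpace ℝ E]
    {f f' : ℝ → E} {a b : E} (hd : ∀ t, 0 < t → HasDerivAt f (f' t) t)
    (hf : Tendsto f atTop (𝓝 a)) (hf' : Tendsto f' atTop (𝓝 b)) : b = 0 := by
  have h1 : Tendsto (fun t => f (t + 1) - f t) atTop (𝓝 0) := by
    simpa using (hf.comp (tendsto_atTop_add_const_right _ 1 tendsto_id)).sub hf
  -- Mean value inequality on `[t, t + 1]` for `s ↦ f s - s • b`, whose derivative is eventually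
  -- small.
  have h2 : Tendsto (fun t => f (t + 1) - f t) atTop (𝓝 b) := by
    rw [Metric.tendsto_atTop] at hf' ⊢
    intro ε hε
    obtain ⟨N, hN⟩ := hf' (ε / 2) (half_pos hε)
    refine ⟨max N 1, fun t ht => ?_⟩
    have ht1 : 1 ≤ t := (le_max_right _ _).trans ht
    have htN : N ≤ t := (le_max_left _ _).trans ht
    have hg : ∀ x ∈ Set.Icc t (t + 1),
        HasDerivWithinAt (fun s => f s - s • b) (f' x - b) (Set.Icc t (t + 1)) x := by
      intro x hx
      have hb : HasDerivAt (fun s : ℝ => s • b) ((1 : ℝ) • b) x :=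
        (hasDerivAt_id x).smul_const b
      rw [one_smul] at hb
      exact ((hd x (by linarith [hx.1])).sub hb).hasDerivWithinAt
    have := (convex_Icc t (t + 1)).norm_image_sub_le_of_norm_hasDerivWithin_le (C := ε / 2) hg
      (fun x hx => by
        have := hN x (htN.trans hx.1)
        rw [dist_eq_norm] at this
        exact this.le)
      (Set.left_mem_Icc.mpr (by linarith)) (Set.right_mem_Icc.mpr (by linarith))
    rw [dist_eq_norm]
    have e : f (t + 1) - f t - b = f (t + 1) - (t + 1) • b - (f t - t • b) := by
      rw [add_smul, one_smul]; abel
    rw [e]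
    refine this.trans_lt ?_
    simp
    linarith
  exact tendsto_nhds_unique h2 h1

variable [DecidableEq ι]

/-- An invertible positive semidefinite matrix is positive definite. This replaces the open
condition `M ≻ 0` by the closed condition `M * X = 1` with `X ⪰ 0`, which survives limits in the
compactness arguments. -/
theorem posDef_of_mul_eq_one {M X : Matrix ι ι 𝕜} (hX : X.PosSemidef) (h : M * X = 1) :
    M = X⁻¹ ∧ M.PosDef := by
  have e : M = X⁻¹ := (Matrix.inv_eq_left_inv h).symm
  refine ⟨e, e ▸ Matrix.PosDef.inv ?_⟩
  rw [hX.posDef_iff_isUnit]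
  exact IsUnit.of_mul_eq_one_right _ h

theorem posDef_of_posSemidef_sub {n : Type*} {M N : Matrix n n 𝕜} (hM : M.PosDef) (h : (N - M).PosSemidef) :
    N.PosDef := by
  simpa using hM.add_posSemidef h

theorem isUnit_det_of_posDef {M : Matrix ι ι 𝕜} (hM : M.PosDef) : IsUnit M.det :=
  (Matrix.isUnit_iff_isUnit_det _).mp hM.isUnit

/-- Inversion is antitone in the Loewner order. -/
theorem posSemidef_inv_sub_inv {M N : Matrix ι ι 𝕜} (hM : M.PosDef) (hN : N.PosDef)
    (h : (N - M).PosSemidef) : (M⁻¹ - N⁻¹).PosSemidef := by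
  have uM := isUnit_det_of_posDef hM
  have uN := isUnit_det_of_posDef hN
  -- The identity used is `M⁻¹ - N⁻¹ = (M⁻¹ - N⁻¹) M (M⁻¹ - N⁻¹) + N⁻¹ (N - M) N⁻¹`.
  have h1 := hM.posSemidef.conjTranspose_mul_mul_same (M⁻¹ - N⁻¹)
  have h2 := h.conjTranspose_mul_mul_same N⁻¹
  rw [(hM.inv.isHermitian.sub hN.inv.isHermitian).eq] at h1
  rw [hN.inv.isHermitian.eq] at h2
  convert h1.add h2 using 1
  have a1 := Matrix.nonsing_inv_mul M uM
  have a2 := Matrix.mul_nonsing_inv M uM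
  have a3 := Matrix.nonsing_inv_mul N uN
  generalize M⁻¹ = X at *
  generalize N⁻¹ = Y at *
  simp only [sub_mul, mul_sub, a1, a3, one_mul]
  rw [mul_assoc Y M X, a2]
  simp

theorem continuousAt_inv_of_isUnit {M : Matrix ι ι 𝕜} (hM : IsUnit M.det) :
    ContinuousAt Inv.inv M := by
  apply continuousAt_matrix_inv
  rw [Ring.inverse_eq_inv']
  exact continuousAt_inv₀ hM.ne_zero

theorem hasDerivAt_matrix_inv {M : ℝ → Matrix ι ι 𝕜} {M' : Matrix ι ι 𝕜} {t : ℝ}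
    (h : HasDerivAt M M' t) (hu : IsUnit (M t)) :
    HasDerivAt (fun s => (M s)⁻¹) (-((M t)⁻¹ * M' * (M t)⁻¹)) t := by
  obtain ⟨u, hu⟩ := hu
  have h1 : HasFDerivAt Ring.inverse _ (M t) := hu ▸ hasFDerivAt_ringInverse (𝕜 := ℝ) u
  have h2 := h1.comp_hasDerivAt t h
  have e1 : (fun s => (M s)⁻¹) = Ring.inverse ∘ M :=
    funext fun s => Matrix.nonsing_inv_eq_ringInverse _
  have e2 : (M t)⁻¹ = ((u⁻¹ : (Matrix ι ι 𝕜)ˣ) : Matrix ι ι 𝕜) := by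
    rw [Matrix.nonsing_inv_eq_ringInverse, ← hu, Ring.inverse_unit]
  rw [e1, e2]
  exact h2

end MatrixLemmas

/-! ### The finite-horizon Gramian and existence of finite-horizon optima -/

section Gramian

open scoped ComplexOrder Matrix Matrix.Norms.Operator

theorem hasDerivAt_linearMap_comp {E F : Type*} [NormedAddCommGroup E] [NormedSpace ℝ E]
    [FiniteDimensional ℝ E] [NormedAddCommGroup F] [NormedSpace ℝ F] (l : E →ₗ[ℝ] F)
    {f : ℝ → E} {f' : E} {t : ℝ} (h : HasDerivAt f f' t) :
    HasDerivAt (fun s => l (f s)) (l f') t :=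
  (LinearMap.toContinuousLinearMap l).hasFDerivAt.comp_hasDerivAt t h

variable {n : ℕ} (A : Matrix (Fin n) (Fin n) ℝ)

/-- The integrand `exp(tA) diag(p) exp(tAᵀ)` of the controllability Gramian. -/
noncomputable def gramianIntegrand (p : Fin n → ℝ) (t : ℝ) : Matrix (Fin n) (Fin n) ℝ :=
  NormedSpace.exp (t • A) * Matrix.diagonal p * NormedSpace.exp (t • A.transpose)

theorem gramianIntegrand_eq (p : Fin n → ℝ) (t : ℝ) : gramianIntegrand A p t =
    NormedSpace.exp (t • A) * Matrix.diagonal p * (NormedSpace.exp (t • A))ᴴ := by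
  rw [gramianIntegrand, Matrix.conjTranspose_eq_transpose_of_trivial, ← Matrix.exp_transpose,
    Matrix.transpose_smul]

theorem hasDerivAt_gramianIntegrand (p : Fin n → ℝ) (t : ℝ) :
    HasDerivAt (gramianIntegrand A p)
      (A * gramianIntegrand A p t + gramianIntegrand A p t * A.transpose) t := by
  have h1 := hasDerivAt_exp_smul_const' (𝕂 := ℝ) A t
  have h2 := hasDerivAt_exp_smul_const (𝕂 := ℝ) A.transpose t
  have h := (h1.mul_const (Matrix.diagonal p)).mul h2
  have e : A * gramianIntegrand A p t + gramianIntegrand A p t * A.transpose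
      = A * NormedSpace.exp (t • A) * Matrix.diagonal p * NormedSpace.exp (t • A.transpose)
        + NormedSpace.exp (t • A) * Matrix.diagonal p
          * (NormedSpace.exp (t • A.transpose) * A.transpose) := by
    simp only [gramianIntegrand, mul_assoc]
  rw [e]
  exact h

theorem continuous_gramianIntegrand (p : Fin n → ℝ) : Continuous (gramianIntegrand A p) :=
  continuous_iff_continuousAt.mpr fun t => (hasDerivAt_gramianIntegrand A p t).continuousAt

theorem continuous_gramianIntegrand_apply (p : Fin n → ℝ) (i j : Fin n) :
    Continuous fun t => gramianIntegrand A p t i j :=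
  (continuous_gramianIntegrand A p).matrix_elem i j

theorem gramian_apply (p : Fin n → ℝ) (T : ℝ) (i j : Fin n) :
    gramian A p T i j = ∫ t in (0 : ℝ)..T, gramianIntegrand A p t i j := rfl

theorem gramian_zero (p : Fin n → ℝ) : gramian A p 0 = 0 := by
  ext i j
  simp [gramian_apply]

theorem gramian_add (p q : Fin n → ℝ) (T : ℝ) :
    gramian A (p + q) T = gramian A p T + gramian A q T := by
  ext i j
  rw [Matrix.add_apply, gramian_apply, gramian_apply, gramian_apply,
    ← intervalIntegral.integral_add
      ((continuous_gramianIntegrand_apply A p i j).intervalIntegrable _ _)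
      ((continuous_gramianIntegrand_apply A q i j).intervalIntegrable _ _)]
  congr 1
  funext t
  have : Matrix.diagonal (p + q) = Matrix.diagonal p + Matrix.diagonal q :=
    (Matrix.diagonal_add p q).symm
  simp only [gramianIntegrand, this, mul_add, add_mul, Matrix.add_apply]

theorem gramian_smul (c : ℝ) (p : Fin n → ℝ) (T : ℝ) :
    gramian A (c • p) T = c • gramian A p T := by
  ext i j
  rw [Matrix.smul_apply, gramian_apply, gramian_apply, smul_eq_mul,
    ← intervalIntegral.integral_const_mul]
  congr 1
  funext t
  simp only [gramianIntegrand, Matrix.diagonal_smul, Matrix.mul_smul, Matrix.smul_mul,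
    Matrix.smul_apply, smul_eq_mul]

theorem continuous_gramian (T : ℝ) : Continuous fun p => gramian A p T := by
  let l : (Fin n → ℝ) →ₗ[ℝ] Matrix (Fin n) (Fin n) ℝ :=
    { toFun := fun p => gramian A p T
      map_add' := fun p q => gramian_add A p q T
      map_smul' := fun c p => gramian_smul A c p T }
  exact l.continuous_of_finiteDimensional

theorem hasDerivAt_gramian_integrand (p : Fin n → ℝ) (T : ℝ) :
    HasDerivAt (gramian A p) (gramianIntegrand A p T) T := by
  refine hasDerivAt_pi.mpr fun i => hasDerivAt_pi.mpr fun j => ?_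
  exact intervalIntegral.integral_hasDerivAt_right
    ((continuous_gramianIntegrand_apply A p i j).intervalIntegrable _ _)
    ((continuous_gramianIntegrand_apply A p i j).stronglyMeasurableAtFilter _ _)
    (continuous_gramianIntegrand_apply A p i j).continuousAt

/-- The integrand `F` solves `F' = A F + F Aᵀ`, so `F - (A G + G Aᵀ)` has zero derivative, and at
time 0 it equals `diag(p)`. As `F` is also `G'`, the Gramian solves a differential Lyapunov
equation. -/
theorem gramianIntegrand_eq_lyapunov (p : Fin n → ℝ) (T : ℝ) :
    gramianIntegrand A p T
      = A * gramian A p T + gramian A p T * A.transpose + Matrix.diagonal p := by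
  let f : ℝ → Matrix (Fin n) (Fin n) ℝ := fun t =>
    gramianIntegrand A p t - (A * gramian A p t + gramian A p t * A.transpose)
  have hf : ∀ t, HasDerivAt f 0 t := by
    intro t
    have h := (hasDerivAt_gramianIntegrand A p t).sub
      (((hasDerivAt_gramian_integrand A p t).const_mul A).add
        ((hasDerivAt_gramian_integrand A p t).mul_const A.transpose))
    rw [sub_self] at h
    exact h
  have h := is_const_of_deriv_eq_zero (fun t => (hf t).differentiableAt)
    (fun t => (hf t).deriv) T 0
  simp only [f, gramian_zero] at h
  rw [sub_eq_iff_eq_add] at h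
  rw [h]
  simp [gramianIntegrand, add_comm]

variable {A}

theorem posSemidef_gramianIntegrand {p : Fin n → ℝ} (hp : ∀ i, 0 ≤ p i) (t : ℝ) :
    (gramianIntegrand A p t).PosSemidef := by
  rw [gramianIntegrand_eq]
  exact (Matrix.posSemidef_diagonal_iff.mpr hp).mul_mul_conjTranspose_same _

theorem posDef_gramianIntegrand {p : Fin n → ℝ} (hp : ∀ i, 0 < p i) (t : ℝ) :
    (gramianIntegrand A p t).PosDef := by
  rw [gramianIntegrand_eq]
  exact (Matrix.PosDef.diagonal hp).mul_mul_conjTranspose_same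
    (Matrix.vecMul_injective_of_isUnit (Matrix.isUnit_exp _))

theorem isHermitian_gramian {p : Fin n → ℝ} (hp : ∀ i, 0 ≤ p i) (T : ℝ) :
    (gramian A p T).IsHermitian := by
  ext i j
  rw [Matrix.conjTranspose_apply, gramian_apply, gramian_apply, star_trivial]
  congr 1
  funext t
  exact (posSemidef_gramianIntegrand hp t).isHermitian.apply i j

theorem hasDerivAt_gramian_quadratic (p x : Fin n → ℝ) (T : ℝ) :
    HasDerivAt (fun t => star x ⬝ᵥ (gramian A p t *ᵥ x))
      (star x ⬝ᵥ (gramianIntegrand A p T *ᵥ x)) T := by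
  let l : Matrix (Fin n) (Fin n) ℝ →ₗ[ℝ] ℝ :=
    { toFun := fun M => star x ⬝ᵥ (M *ᵥ x)
      map_add' := fun M N => by rw [Matrix.add_mulVec, dotProduct_add]
      map_smul' := fun c M => by simp [Matrix.smul_mulVec] }
  exact hasDerivAt_linearMap_comp l (hasDerivAt_gramian_integrand A p T)

theorem posSemidef_gramian_sub {p : Fin n → ℝ} (hp : ∀ i, 0 ≤ p i) {s t : ℝ} (hst : s ≤ t) :
    (gramian A p t - gramian A p s).PosSemidef := by
  refine .of_dotProduct_mulVec_nonneg
    ((isHermitian_gramian hp t).sub (isHermitian_gramian hp s)) fun x => ?_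
  have := monotone_of_hasDerivAt_nonneg (fun T => hasDerivAt_gramian_quadratic (A := A) p x T)
    (fun T => (posSemidef_gramianIntegrand hp T).dotProduct_mulVec_nonneg x) hst
  rw [Matrix.sub_mulVec, dotProduct_sub]
  exact sub_nonneg.mpr this

theorem posSemidef_gramian {p : Fin n → ℝ} (hp : ∀ i, 0 ≤ p i) {t : ℝ} (ht : 0 ≤ t) :
    (gramian A p t).PosSemidef := by
  simpa [gramian_zero] using posSemidef_gramian_sub (A := A) hp ht

/-- Each quadratic form of the Gramian has a positive derivative and starts at 0. Positive weights
are thus feasible for every horizon, whatever `A` is. -/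
theorem posDef_gramian {p : Fin n → ℝ} (hp : ∀ i, 0 < p i) {t : ℝ} (ht : 0 < t) :
    (gramian A p t).PosDef := by
  refine .of_dotProduct_mulVec_pos (isHermitian_gramian (fun i => (hp i).le) t) fun x hx => ?_
  have := strictMono_of_hasDerivAt_pos (fun T => hasDerivAt_gramian_quadratic (A := A) p x T)
    (fun T => (posDef_gramianIntegrand hp T).dotProduct_mulVec_pos hx) ht
  simpa [gramian_zero] using this

/-- The finite-horizon problem has an optimal solution. -/
theorem exists_isFiniteAECS (hn : 0 < n) {T : ℝ} (hT : 0 < T) : ∃ p, IsFiniteAECS A T p := by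
  have : Nonempty (Fin n) := ⟨⟨0, hn⟩⟩
  let u : Fin n → ℝ := fun _ => (n : ℝ)⁻¹
  have hn' : (0 : ℝ) < n := Nat.cast_pos.mpr hn
  have hu : u ∈ finiteFeasible A T := by
    refine ⟨⟨fun i => (inv_pos.mpr hn').le, ?_⟩, posDef_gramian (fun i => inv_pos.mpr hn') hT⟩
    simp [u, hn'.ne']
  set c := ((gramian A u T)⁻¹).trace with hc
  -- The inverse is carried as a second variable. The bound `c`, the value at the uniform vector,
  -- makes the sublevel set compact and nonempty.
  let S : Set ((Fin n → ℝ) × Matrix (Fin n) (Fin n) ℝ) :=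
    (stdSimplex ℝ (Fin n) ×ˢ {M | M.PosSemidef ∧ M.trace ≤ c}) ∩ {z | gramian A z.1 T * z.2 = 1}
  have hS : IsCompact S :=
    ((isCompact_stdSimplex ℝ (Fin n)).prod (isCompact_posSemidef_trace_le c)).inter_right
      (isClosed_eq (((continuous_gramian A T).comp continuous_fst).matrix_mul continuous_snd)
        continuous_const)
  have hmem : ∀ q ∈ finiteFeasible A T, ((gramian A q T)⁻¹).trace ≤ c →
      (q, (gramian A q T)⁻¹) ∈ S := fun q hq hqc =>
    ⟨⟨hq.1, hq.2.inv.posSemidef, hqc⟩, Matrix.mul_nonsing_inv _ (isUnit_det_of_posDef hq.2)⟩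
  obtain ⟨⟨p, X⟩, ⟨⟨hp, hX, hXc⟩, hpX⟩, hmin⟩ := hS.exists_isMinOn ⟨_, hmem u hu le_rfl⟩
    (f := fun z => z.2.trace) continuous_snd.matrix_trace.continuousOn
  obtain ⟨he, hpd⟩ := posDef_of_mul_eq_one hX hpX
  have heX : (gramian A p T)⁻¹ = X := Matrix.inv_eq_right_inv hpX
  refine ⟨p, ⟨hp, hpd⟩, fun q hq => ?_⟩
  rw [heX]
  by_cases hqc : ((gramian A q T)⁻¹).trace ≤ c
  · exact hmin (hmem q hq hqc)
  · exact hXc.trans (le_of_not_ge hqc)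

end Gramian

/-! ### Lyapunov and Riccati equations for Jordan matrices -/

section Jordan

open scoped ComplexOrder Matrix Matrix.Norms.Operator

variable {m : ℕ} {size : Fin m → ℕ} {eig : Fin m → ℂ}

theorem jordanMatrix_apply_self (x : Σ i, Fin (size i)) :
    jordanMatrix size eig x x = eig x.1 := by
  obtain ⟨i, a⟩ := x
  simp [jordanMatrix, jordanBlock, Matrix.blockDiagonal'_apply]

theorem jordanMatrix_apply_succ (i : Fin m) (a b : Fin (size i)) (h : (a : ℕ) + 1 = b) :
    jordanMatrix size eig ⟨i, a⟩ ⟨i, b⟩ = 1 := by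
  have hab : a ≠ b := by rintro rfl; omega
  simp [jordanMatrix, jordanBlock, hab, h]

theorem eq_of_jordanMatrix_apply_ne_zero {x z : Σ i, Fin (size i)} (hne : z ≠ x)
    (h : jordanMatrix size eig x z ≠ 0) :
    ∃ (i : Fin m) (a b : Fin (size i)), x = ⟨i, a⟩ ∧ z = ⟨i, b⟩ ∧ (a : ℕ) + 1 = b := by
  obtain ⟨i, a⟩ := x
  obtain ⟨j, b⟩ := z
  by_cases hij : i = j
  · subst hij
    have hab : a ≠ b := fun h => hne (by rw [h])
    simp only [jordanMatrix, jordanBlock, Matrix.blockDiagonal'_apply_eq, Matrix.of_apply,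
      if_neg hab] at h
    exact ⟨i, a, b, rfl, rfl, by_contra fun h' => h (if_neg h')⟩
  · exact absurd (Matrix.blockDiagonal'_apply_ne _ _ _ hij) h

/-- Left multiplication by a Jordan matrix: a row is scaled by the eigenvalue and the next row of
the same block, if there is one, is added. -/
theorem jordanMatrix_mul_apply {κ : Type*} (x : Σ i, Fin (size i)) :
    (∀ (M : Matrix (Σ i, Fin (size i)) κ ℂ) y,
      (jordanMatrix size eig * M) x y = eig x.1 * M x y) ∨
    ∃ z : Σ i, Fin (size i), size z.1 - (z.2 : ℕ) < size x.1 - (x.2 : ℕ) ∧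
      ∀ (M : Matrix (Σ i, Fin (size i)) κ ℂ) y,
        (jordanMatrix size eig * M) x y = eig x.1 * M x y + M z y := by
  obtain ⟨i, a⟩ := x
  by_cases ha : (a : ℕ) + 1 < size i
  · refine Or.inr ⟨⟨i, ⟨a + 1, ha⟩⟩, by simp only; omega, fun M y => ?_⟩
    have hne : (⟨i, a⟩ : Σ i, Fin (size i)) ≠ ⟨i, ⟨a + 1, ha⟩⟩ := by
      intro h
      have := congrArg Fin.val (eq_of_heq (Sigma.mk.inj h).2)
      simp at this
    rw [Matrix.mul_apply, Fintype.sum_eq_add _ _ hne, jordanMatrix_apply_self,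
      jordanMatrix_apply_succ _ _ _ rfl, one_mul]
    rintro w ⟨hw1, hw2⟩
    by_contra hw
    obtain ⟨j, b, c, h1, rfl, h3⟩ := eq_of_jordanMatrix_apply_ne_zero hw1 (left_ne_zero_of_mul hw)
    cases h1
    exact hw2 (by congr 1; exact Fin.ext h3.symm)
  · refine Or.inl fun M y => ?_
    rw [Matrix.mul_apply, Fintype.sum_eq_single ⟨i, a⟩, jordanMatrix_apply_self]
    intro w hw1
    by_contra hw
    obtain ⟨j, b, c, h1, rfl, h3⟩ := eq_of_jordanMatrix_apply_ne_zero hw1 (left_ne_zero_of_mul hw)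
    cases h1
    exact ha (h3 ▸ c.isLt)

/-- Right multiplication by a Jordan matrix, when the columns belonging to earlier positions of the
same block vanish. -/
theorem mul_jordanMatrix_apply {κ : Type*} (M : Matrix κ (Σ i, Fin (size i)) ℂ) (y : κ)
    (x : Σ i, Fin (size i))
    (h : ∀ z : Σ i, Fin (size i), (z.2 : ℕ) < x.2 → M y z = 0) :
    (M * jordanMatrix size eig) y x = M y x * eig x.1 := by
  rw [Matrix.mul_apply, Fintype.sum_eq_single x, jordanMatrix_apply_self]
  intro w hw
  by_contra hne
  obtain ⟨i, a, b, rfl, rfl, h3⟩ :=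
    eq_of_jordanMatrix_apply_ne_zero hw.symm (right_ne_zero_of_mul hne)
  exact left_ne_zero_of_mul hne (h _ (by simp only; omega))

/-- Along a differential Lyapunov inequality with a stable Jordan matrix, positive semidefinite
matrices stay bounded. -/
theorem exists_re_apply_le (heig : ∀ i, (eig i).re < 0)
    {P : Matrix (Σ i, Fin (size i)) (Σ i, Fin (size i)) ℂ}
    {M : ℝ → Matrix (Σ i, Fin (size i)) (Σ i, Fin (size i)) ℂ}
    (hM : ∀ t, 0 < t → (M t).PosSemidef)
    (hN : ∀ t, 0 < t → (jordanMatrix size eig * M t + M t * (jordanMatrix size eig)ᴴ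
      + P).PosSemidef) (x : Σ i, Fin (size i)) :
    ∃ c, ∀ t, 0 < t → (M t x x).re ≤ c := by
  -- Induction from the last position of a block backwards: row `x` of `J M` involves only rows `x`
  -- and its successor.
  suffices H : ∀ (k : ℕ) (x : Σ i, Fin (size i)), size x.1 - (x.2 : ℕ) = k →
      ∃ c, ∀ t, 0 < t → (M t x x).re ≤ c from H _ x rfl
  intro k
  induction k using Nat.strong_induction_on with
  | _ k ih =>
    intro x hx
    set r := -(eig x.1).re with hr
    have hrpos : 0 < r := neg_pos.mpr (heig _)
    -- Semidefiniteness of the Lyapunov expression yields an algebraic inequality at each time, so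
    -- no differential inequality has to be integrated.
    have hdiag : ∀ t, 0 < t →
        0 ≤ 2 * ((jordanMatrix size eig * M t) x x).re + (P x x).re := by
      intro t ht
      have h := re_apply_nonneg (hN t ht) x
      have e : (M t * (jordanMatrix size eig)ᴴ) x x
          = star ((jordanMatrix size eig * M t) x x) := by
        rw [← Matrix.conjTranspose_apply, Matrix.conjTranspose_mul, (hM t ht).isHermitian.eq]
      rw [Matrix.add_apply, Matrix.add_apply, e] at h
      simp only [RCLike.re_eq_complex_re, Complex.add_re, Complex.star_def, Complex.conj_re] at h
      linarith
    have him : ∀ t, 0 < t → (eig x.1 * M t x x).re = -r * (M t x x).re := by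
      intro t ht
      have : (M t x x).im = 0 := by
        have := (Complex.nonneg_iff.mp ((hM t ht).diag_nonneg (i := x))).2
        exact this.symm
      rw [Complex.mul_re, this, hr]
      ring
    rcases jordanMatrix_mul_apply (eig := eig) (κ := Σ i, Fin (size i)) x with h | ⟨z, hz, h⟩
    · refine ⟨(P x x).re / (2 * r), fun t ht => ?_⟩
      have h1 := hdiag t ht
      rw [h, him t ht] at h1
      rw [le_div_iff₀ (by positivity)]
      linarith
    · obtain ⟨c, hc⟩ := ih _ (hx ▸ hz) z rfl
      refine ⟨((P x x).re + r⁻¹ * c) / r, fun t ht => ?_⟩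
      have h1 := hdiag t ht
      rw [h, Complex.add_re, him t ht] at h1
      -- With this weight the cross term costs `r * M x x`, half of the available damping `2 * r * M
      -- x x`.
      have h2 := two_mul_norm_apply_le (hM t ht) (inv_pos.mpr hrpos) z x
      rw [inv_inv] at h2
      simp only [RCLike.re_eq_complex_re] at h2
      have h3 := Complex.re_le_norm (M t z x)
      have h4 : r⁻¹ * (M t z z).re ≤ r⁻¹ * c :=
        mul_le_mul_of_nonneg_left (hc t ht) (inv_pos.mpr hrpos).le
      rw [le_div_iff₀ hrpos]
      linarith

/-- A monotone positive semidefinite solution of the differential Lyapunov equation of a stable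
Jordan matrix converges to the solution of the Lyapunov equation. -/
theorem exists_tendsto_lyapunov (heig : ∀ i, (eig i).re < 0)
    {P : Matrix (Σ i, Fin (size i)) (Σ i, Fin (size i)) ℂ}
    {M : ℝ → Matrix (Σ i, Fin (size i)) (Σ i, Fin (size i)) ℂ}
    (hM : ∀ t, 0 < t → (M t).PosSemidef)
    (hmono : ∀ s t, 0 < s → s ≤ t → (M t - M s).PosSemidef)
    (hN : ∀ t, 0 < t → (jordanMatrix size eig * M t + M t * (jordanMatrix size eig)ᴴ
      + P).PosSemidef)
    (hd : ∀ t, 0 < t → HasDerivAt M (jordanMatrix size eig * M t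
      + M t * (jordanMatrix size eig)ᴴ + P) t) :
    ∃ V, Tendsto M atTop (𝓝 V) ∧
      jordanMatrix size eig * V + V * (jordanMatrix size eig)ᴴ + P = 0 := by
  choose c hc using exists_re_apply_le heig hM hN
  obtain ⟨V, hV⟩ := exists_tendsto_of_posSemidef_sub (c := ∑ x, c x) hmono fun t ht => by
    rw [Matrix.trace, map_sum]
    exact Finset.sum_le_sum fun x _ => hc x t ht
  refine ⟨V, hV, eq_zero_of_tendsto_of_tendsto_deriv hd hV ?_⟩
  exact ((tendsto_const_nhds.mul hV).add (hV.mul tendsto_const_nhds)).add tendsto_const_nhds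

/-- A positive semidefinite solution of the algebraic Riccati equation vanishes on the generalized
eigenvectors of eigenvalues with nonnegative real parts. -/
theorem riccati_apply_inr_eq_zero {ι : Type*} [Fintype ι] [DecidableEq ι]
    (heig : ∀ i, 0 ≤ (eig i).re) {K : Matrix ι ι ℂ}
    {Y B : Matrix (ι ⊕ (Σ i, Fin (size i))) (ι ⊕ (Σ i, Fin (size i))) ℂ}
    (hY : Y.PosSemidef) (hB : B.PosDef)
    (h : Y * Matrix.fromBlocks K 0 0 (jordanMatrix size eig)
      + (Matrix.fromBlocks K 0 0 (jordanMatrix size eig))ᴴ * Y + Y * B * Y = 0)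
    (w : ι ⊕ (Σ i, Fin (size i))) (x : Σ i, Fin (size i)) : Y w (Sum.inr x) = 0 := by
  -- Induction from the first position of a block: right multiplication by `J` brings in the
  -- preceding column, already known to vanish.
  suffices H : ∀ (k : ℕ) (x : Σ i, Fin (size i)), (x.2 : ℕ) = k →
      ∀ w, Y w (Sum.inr x) = 0 from H _ x rfl w
  intro k
  induction k using Nat.strong_induction_on with
  | _ k ih =>
    intro x hx
    set J := Matrix.fromBlocks K 0 0 (jordanMatrix size eig) with hJ
    have h1 : (Y * J) (Sum.inr x) (Sum.inr x) = Y (Sum.inr x) (Sum.inr x) * eig x.1 := by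
      have := mul_jordanMatrix_apply (eig := eig) (Y.submatrix id Sum.inr) (Sum.inr x) x
        (fun z hz => ih _ (hx ▸ hz) z rfl _)
      rw [Matrix.submatrix_apply, id] at this
      rw [← this, Matrix.mul_apply, Matrix.mul_apply, Fintype.sum_sum_type]
      simp [hJ]
    have h2 : (Jᴴ * Y) (Sum.inr x) (Sum.inr x) = star ((Y * J) (Sum.inr x) (Sum.inr x)) := by
      rw [← Matrix.conjTranspose_apply, Matrix.conjTranspose_mul, hY.isHermitian.eq]
    have h3 : (Y * B * Y) (Sum.inr x) (Sum.inr x)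
        = star (fun w => Y w (Sum.inr x)) ⬝ᵥ (B *ᵥ fun w => Y w (Sum.inr x)) := by
      rw [mul_assoc, Matrix.mul_apply]
      refine Finset.sum_congr rfl fun z _ => ?_
      rw [Pi.star_apply, hY.isHermitian.apply]
      rfl
    -- With `v` the column at `x`, the diagonal entry of the equation reads `2 Re(eig) Y x x + v* B
    -- v = 0`. Both terms are nonnegative and `B` is definite, so `v = 0`.
    by_contra hne
    have hv : (fun w => Y w (Sum.inr x)) ≠ 0 := fun h0 => hne fun w => congrFun h0 w
    have hpos := (Complex.pos_iff.mp (hB.dotProduct_mulVec_pos hv)).1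
    have hyy := Complex.nonneg_iff.mp (hY.diag_nonneg (i := Sum.inr x))
    have h0 := congrArg Complex.re (congrFun (congrFun h (Sum.inr x)) (Sum.inr x))
    rw [Matrix.add_apply, Matrix.add_apply, h2, h1, h3] at h0
    simp only [Complex.add_re, Complex.star_def, Complex.conj_re, Complex.mul_re, ← hyy.2,
      Matrix.zero_apply, Complex.zero_re] at h0
    have := mul_nonneg hyy.1 (heig x.1)
    linarith

end Jordan

/-! ### Passing from real to complex matrices -/

section Complexification

open scoped ComplexOrder Matrix Matrix.Norms.Operator

theorem posSemidef_map_ofReal {n : Type*} [Fintype n] {M : Matrix n n ℝ} (hM : M.PosSemidef) :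
    (M.map Complex.ofReal).PosSemidef := by
  obtain ⟨m, v, rfl⟩ := Matrix.posSemidef_iff_eq_sum_vecMulVec.mp hM
  refine Matrix.posSemidef_iff_eq_sum_vecMulVec.mpr ⟨m, fun k i => (v k i : ℂ), ?_⟩
  ext i j
  simp [Matrix.sum_apply, Matrix.vecMulVec_apply]

theorem map_ofReal_inv {n : Type*} [Fintype n] [DecidableEq n] {M : Matrix n n ℝ}
    (hM : IsUnit M.det) : M.map Complex.ofReal * M⁻¹.map Complex.ofReal = 1 := by
  have h := congrArg (fun N : Matrix n n ℝ => N.map Complex.ofRealHom) (Matrix.mul_nonsing_inv M hM)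
  simp only [Matrix.map_mul] at h
  refine h.trans ?_
  exact Matrix.map_one _ (map_zero _) (map_one _)

theorem posDef_map_ofReal {n : Type*} [Fintype n] [DecidableEq n] {M : Matrix n n ℝ}
    (hM : M.PosDef) : (M.map Complex.ofReal).PosDef := by
  rw [(posSemidef_map_ofReal hM.posSemidef).posDef_iff_isUnit]
  exact IsUnit.of_mul_eq_one _ (map_ofReal_inv (isUnit_det_of_posDef hM))

end Complexification

/-! ### Jordan coordinates, comparison of the two objectives, and convergence -/

namespace JordanDecomposition

open scoped ComplexOrder Matrix Matrix.Norms.Operator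

variable {n : ℕ} {A : Matrix (Fin n) (Fin n) ℝ} (d : JordanDecomposition A)

/-- The index type of the coordinates belonging to the Jordan form. -/
abbrev Idx : Type := (Σ i, Fin (d.sizeStable i)) ⊕ (Σ i, Fin (d.sizeOther i))

/-- The full Jordan matrix `diag(J₋, J')`. -/
def jordanForm : Matrix d.Idx d.Idx ℂ :=
  Matrix.fromBlocks d.JStable 0 0 (jordanMatrix d.sizeOther d.eigOther)

/-- The change of coordinates `M ↦ Q⁻¹ M Q⁻*` applied to real matrices. -/
def congruence : Matrix (Fin n) (Fin n) ℝ →ₗ[ℝ] Matrix d.Idx d.Idx ℂ where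
  toFun M := d.Qinv * M.map Complex.ofReal * d.Qinvᴴ
  map_add' M N := by
    rw [Matrix.map_add _ Complex.ofReal_add, Matrix.mul_add, Matrix.add_mul]
  map_smul' c M := by
    have : (c • M).map Complex.ofReal = c • M.map Complex.ofReal := by
      ext i j
      simp
    simp only [this, Matrix.mul_smul, Matrix.smul_mul, RingHom.id_apply]

theorem congruence_apply (M : Matrix (Fin n) (Fin n) ℝ) :
    d.congruence M = d.Qinv * M.map Complex.ofReal * d.Qinvᴴ := rfl

theorem Qinv_mul_map : d.Qinv * A.map Complex.ofReal = d.jordanForm * d.Qinv := by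
  have h := congrArg (· * d.Qinv) d.Qinv_mul_A_mul_Q
  simp only [Matrix.mul_assoc, d.Q_mul_Qinv, Matrix.mul_one] at h
  exact h

theorem congruence_mul_left (M : Matrix (Fin n) (Fin n) ℝ) :
    d.congruence (A * M) = d.jordanForm * d.congruence M := by
  have : (A * M).map Complex.ofReal = A.map Complex.ofReal * M.map Complex.ofReal :=
    Matrix.map_mul (f := Complex.ofRealHom)
  rw [congruence_apply, congruence_apply, this, ← Matrix.mul_assoc, d.Qinv_mul_map]
  simp only [Matrix.mul_assoc]

theorem congruence_mul_right (M : Matrix (Fin n) (Fin n) ℝ) :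
    d.congruence (M * A.transpose) = d.congruence M * d.jordanFormᴴ := by
  have h1 : (M * A.transpose).map Complex.ofReal
      = M.map Complex.ofReal * (A.map Complex.ofReal)ᴴ := by
    have : (A.map Complex.ofReal)ᴴ = A.transpose.map Complex.ofReal := by
      ext i j
      simp
    rw [this]
    exact Matrix.map_mul (f := Complex.ofRealHom)
  have h2 := congrArg Matrix.conjTranspose d.Qinv_mul_map
  rw [Matrix.conjTranspose_mul, Matrix.conjTranspose_mul] at h2
  rw [congruence_apply, congruence_apply, h1, ← Matrix.mul_assoc, Matrix.mul_assoc _ _ d.Qinvᴴ,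
    h2]
  simp only [Matrix.mul_assoc]

theorem posSemidef_congruence {M : Matrix (Fin n) (Fin n) ℝ} (hM : M.PosSemidef) :
    (d.congruence M).PosSemidef :=
  (posSemidef_map_ofReal hM).mul_mul_conjTranspose_same _

theorem posDef_congruence {M : Matrix (Fin n) (Fin n) ℝ} (hM : M.PosDef) :
    (d.congruence M).PosDef := by
  refine (posDef_map_ofReal hM).mul_mul_conjTranspose_same fun x y hxy => ?_
  have := congrArg (fun v => v ᵥ* d.Q) hxy
  simpa [Matrix.vecMul_vecMul, d.Qinv_mul_Q] using this

theorem conjTranspose_Q_mul_Qinv : d.Qinvᴴ * d.Qᴴ = 1 := by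
  rw [← Matrix.conjTranspose_mul, d.Q_mul_Qinv, Matrix.conjTranspose_one]

theorem conjTranspose_Qinv_mul_Q : d.Qᴴ * d.Qinvᴴ = 1 := by
  rw [← Matrix.conjTranspose_mul, d.Qinv_mul_Q, Matrix.conjTranspose_one]

theorem conj_conj (X : Matrix d.Idx d.Idx ℂ) : d.Qᴴ * (d.Qinvᴴ * X * d.Qinv) * d.Q = X := by
  have : d.Qᴴ * (d.Qinvᴴ * X * d.Qinv) * d.Q = (d.Qᴴ * d.Qinvᴴ) * X * (d.Qinv * d.Q) := by
    simp only [Matrix.mul_assoc]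
  rw [this, d.conjTranspose_Qinv_mul_Q, d.Qinv_mul_Q, Matrix.one_mul, Matrix.mul_one]

theorem congruence_mul_inv {M : Matrix (Fin n) (Fin n) ℝ} (hM : IsUnit M.det) :
    d.congruence M * (d.Qᴴ * M⁻¹.map Complex.ofReal * d.Q) = 1 := by
  have : d.congruence M * (d.Qᴴ * M⁻¹.map Complex.ofReal * d.Q)
      = d.Qinv * (M.map Complex.ofReal * ((d.Qinvᴴ * d.Qᴴ) * M⁻¹.map Complex.ofReal)) * d.Q := by
    simp only [congruence_apply, Matrix.mul_assoc]
  rw [this, d.conjTranspose_Q_mul_Qinv, Matrix.one_mul, map_ofReal_inv hM, Matrix.mul_one,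
    d.Qinv_mul_Q]

/-- The trace of the inverse of a real matrix in the coordinates of the Jordan form. -/
theorem trace_inv_eq {M : Matrix (Fin n) (Fin n) ℝ} (hM : IsUnit M.det) :
    M⁻¹.trace = (d.Qinvᴴ * (d.congruence M)⁻¹ * d.Qinv).trace.re := by
  rw [Matrix.inv_eq_right_inv (d.congruence_mul_inv hM)]
  have : d.Qinvᴴ * (d.Qᴴ * M⁻¹.map Complex.ofReal * d.Q) * d.Qinv
      = (d.Qinvᴴ * d.Qᴴ) * M⁻¹.map Complex.ofReal * (d.Q * d.Qinv) := by
    simp only [Matrix.mul_assoc]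
  rw [this, d.conjTranspose_Q_mul_Qinv, d.Q_mul_Qinv, Matrix.one_mul, Matrix.mul_one]
  simp [Matrix.trace]

theorem WStable_unique {B : Matrix (Fin n) (Fin n) ℂ}
    {V : Matrix (Σ i, Fin (d.sizeStable i)) (Σ i, Fin (d.sizeStable i)) ℂ}
    (h : d.JStable * V + V * d.JStableᴴ + d.BStable B = 0) : d.WStable B = V :=
  (existsUnique_lyapunov d.sizeStable d.eigStable d.eigStable_re (d.BStable B)).unique
    (d.WStable_spec B) h

theorem BStable_diagonal (p : Fin n → ℝ) :
    d.BStable (Matrix.diagonal fun i => (p i : ℂ))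
      = (d.congruence (Matrix.diagonal p)).toBlocks₁₁ := by
  have : (Matrix.diagonal p).map Complex.ofReal = Matrix.diagonal fun i => (p i : ℂ) :=
    Matrix.diagonal_map Complex.ofReal_zero
  rw [BStable, congruence_apply, this]

theorem WStableVec_unique {p : Fin n → ℝ}
    {V : Matrix (Σ i, Fin (d.sizeStable i)) (Σ i, Fin (d.sizeStable i)) ℂ}
    (h : d.JStable * V + V * d.JStableᴴ
      + (d.congruence (Matrix.diagonal p)).toBlocks₁₁ = 0) : d.WStableVec p = V :=
  d.WStable_unique (by rwa [d.BStable_diagonal])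

theorem WStableVec_spec (p : Fin n → ℝ) :
    d.JStable * d.WStableVec p + d.WStableVec p * d.JStableᴴ
      + (d.congruence (Matrix.diagonal p)).toBlocks₁₁ = 0 := by
  rw [← d.BStable_diagonal]
  exact d.WStable_spec _

/-- Uniqueness of the Lyapunov solution makes it real-linear in `p`, hence continuous in finite
dimension. -/
theorem continuous_WStableVec : Continuous d.WStableVec := by
  let l : (Fin n → ℝ) →ₗ[ℝ] Matrix (Σ i, Fin (d.sizeStable i)) (Σ i, Fin (d.sizeStable i)) ℂ :=
    { toFun := d.WStableVec
      map_add' := fun p q => d.WStableVec_unique <| by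
        have h := congrArg₂ (· + ·) (d.WStableVec_spec p) (d.WStableVec_spec q)
        have e : (d.congruence (Matrix.diagonal (p + q))).toBlocks₁₁
            = (d.congruence (Matrix.diagonal p)).toBlocks₁₁
              + (d.congruence (Matrix.diagonal q)).toBlocks₁₁ := by
          have : Matrix.diagonal (p + q) = Matrix.diagonal p + Matrix.diagonal q :=
            (Matrix.diagonal_add p q).symm
          rw [this, map_add]
          rfl
        simp only [add_zero] at h
        rw [e, mul_add, add_mul, ← h]
        abel
      map_smul' := fun c p => d.WStableVec_unique <| by
        have h := congrArg (c • ·) (d.WStableVec_spec p)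
        have e : (d.congruence (Matrix.diagonal (c • p))).toBlocks₁₁
            = c • (d.congruence (Matrix.diagonal p)).toBlocks₁₁ := by
          rw [Matrix.diagonal_smul, map_smul]
          rfl
        simp only [smul_zero] at h
        rw [e, RingHom.id_apply, Matrix.mul_smul, Matrix.smul_mul, ← smul_add, ← smul_add, h] }
  exact l.continuous_of_finiteDimensional

theorem toBlocks₁₁_jordanForm_mul (G : Matrix d.Idx d.Idx ℂ) :
    (d.jordanForm * G).toBlocks₁₁ = d.JStable * G.toBlocks₁₁ := by
  conv_lhs => rw [← Matrix.fromBlocks_toBlocks G, jordanForm, Matrix.fromBlocks_multiply]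
  simp

theorem toBlocks₁₁_mul_jordanForm (G : Matrix d.Idx d.Idx ℂ) :
    (G * d.jordanFormᴴ).toBlocks₁₁ = G.toBlocks₁₁ * d.JStableᴴ := by
  conv_lhs => rw [← Matrix.fromBlocks_toBlocks G, jordanForm, Matrix.fromBlocks_conjTranspose,
    Matrix.fromBlocks_multiply]
  simp

theorem congruence_gramianIntegrand (p : Fin n → ℝ) (t : ℝ) :
    d.congruence (gramianIntegrand A p t) = d.jordanForm * d.congruence (gramian A p t)
      + d.congruence (gramian A p t) * d.jordanFormᴴ + d.congruence (Matrix.diagonal p) := by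
  rw [gramianIntegrand_eq_lyapunov, map_add, map_add, congruence_mul_left, congruence_mul_right]

theorem hasDerivAt_congruence_gramian (p : Fin n → ℝ) (t : ℝ) :
    HasDerivAt (fun t => d.congruence (gramian A p t))
      (d.congruence (gramianIntegrand A p t)) t :=
  hasDerivAt_linearMap_comp d.congruence (hasDerivAt_gramian_integrand A p t)

/-- The stable block decouples since the Jordan form is block diagonal. It increases and solves the
stable differential Lyapunov equation, so it stays below its limit, which is `W₋(p)`. -/
theorem posSemidef_WStableVec_sub {p : Fin n → ℝ} (hp : ∀ i, 0 ≤ p i) (T : ℝ) :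
    (d.WStableVec p - (d.congruence (gramian A p T)).toBlocks₁₁).PosSemidef := by
  let M := fun t => (d.congruence (gramian A p t)).toBlocks₁₁
  have hblock : ∀ t, (d.congruence (gramianIntegrand A p t)).toBlocks₁₁
      = d.JStable * M t + M t * d.JStableᴴ
        + (d.congruence (Matrix.diagonal p)).toBlocks₁₁ := by
    intro t
    rw [congruence_gramianIntegrand]
    show (d.jordanForm * d.congruence (gramian A p t)).toBlocks₁₁
      + (d.congruence (gramian A p t) * d.jordanFormᴴ).toBlocks₁₁ + _ = _
    rw [toBlocks₁₁_jordanForm_mul, toBlocks₁₁_mul_jordanForm]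
    rfl
  have hsub : ∀ s t, s ≤ t → (M t - M s).PosSemidef := fun s t hst => by
    have := (d.posSemidef_congruence (posSemidef_gramian_sub (A := A) hp hst)).submatrix Sum.inl
    rw [map_sub] at this
    exact this
  let l : Matrix d.Idx d.Idx ℂ →ₗ[ℝ]
      Matrix (Σ i, Fin (d.sizeStable i)) (Σ i, Fin (d.sizeStable i)) ℂ :=
    { toFun := fun X => X.toBlocks₁₁
      map_add' := fun _ _ => rfl
      map_smul' := fun _ _ => rfl }
  obtain ⟨V, hV, hVeq⟩ := exists_tendsto_lyapunov (M := M) d.eigStable_re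
    (P := (d.congruence (Matrix.diagonal p)).toBlocks₁₁)
    (fun t ht => (d.posSemidef_congruence (posSemidef_gramian hp ht.le)).submatrix Sum.inl)
    (fun s t _ hst => hsub s t hst)
    (fun t _ => by
      have h := (d.posSemidef_congruence (posSemidef_gramianIntegrand (A := A) hp t)).submatrix
        Sum.inl
      exact hblock t ▸ h)
    (fun t _ => by
      have h := hasDerivAt_linearMap_comp l (d.hasDerivAt_congruence_gramian p t)
      exact hblock t ▸ h)
  rw [d.WStableVec_unique hVeq]
  refine isClosed_posSemidef.mem_of_tendsto (hV.sub_const (M T)) ?_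
  filter_upwards [eventually_ge_atTop T] with t ht using hsub T t ht

theorem posDef_WStableVec {p : Fin n → ℝ} (hp : ∀ i, 0 ≤ p i) {T : ℝ}
    (h : (gramian A p T).PosDef) : (d.WStableVec p).PosDef :=
  posDef_of_posSemidef_sub ((d.posDef_congruence h).submatrix Sum.inl_injective)
    (d.posSemidef_WStableVec_sub hp T)

/-- The block-diagonal matrix `diag(W₋(p)⁻¹, 0)`. -/
noncomputable def stableInv (p : Fin n → ℝ) : Matrix d.Idx d.Idx ℂ :=
  Matrix.fromBlocks (d.WStableVec p)⁻¹ 0 0 0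

theorem infiniteObjective_eq (p : Fin n → ℝ) :
    d.infiniteObjective p = (d.Qinvᴴ * d.stableInv p * d.Qinv).trace.re := rfl

theorem posSemidef_fromBlocks_zero {ι κ : Type*} [Fintype ι] [Fintype κ] [DecidableEq ι]
    {M : Matrix ι ι ℂ} (hM : M.PosSemidef) :
    (Matrix.fromBlocks M 0 0 0 : Matrix (ι ⊕ κ) (ι ⊕ κ) ℂ).PosSemidef := by
  have := hM.mul_mul_conjTranspose_same (Matrix.fromRows (1 : Matrix ι ι ℂ) (0 : Matrix κ ι ℂ))
  rw [Matrix.fromRows_mul, Matrix.conjTranspose_fromRows_eq_fromCols_conjTranspose,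
    Matrix.fromRows_mul_fromCols] at this
  simpa only [Matrix.one_mul, Matrix.zero_mul, Matrix.conjTranspose_one, Matrix.conjTranspose_zero,
    Matrix.mul_one, Matrix.mul_zero] using this

/-- With `P = diag(W⁻¹, 0)`, `G⁻¹ - P = (G⁻¹ - P) G (G⁻¹ - P) + (P - P G P)`, and the last term is
`diag(W⁻¹ (W - G₁₁) W⁻¹, 0)`. The singular matrix `P` need not be inverted. -/
theorem posSemidef_inv_congruence_gramian_sub {p : Fin n → ℝ} (hp : ∀ i, 0 ≤ p i) {T : ℝ}
    (h : (gramian A p T).PosDef) :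
    ((d.congruence (gramian A p T))⁻¹ - d.stableInv p).PosSemidef := by
  have hW := d.posDef_WStableVec hp h
  have hG := d.posDef_congruence h
  have hsub := d.posSemidef_WStableVec_sub hp T
  rw [stableInv]
  generalize d.congruence (gramian A p T) = G at *
  generalize d.WStableVec p = W at *
  have uW := isUnit_det_of_posDef hW
  have uG := isUnit_det_of_posDef hG
  set P : Matrix d.Idx d.Idx ℂ := Matrix.fromBlocks W⁻¹ 0 0 0 with hP
  have hPh : Pᴴ = P := by
    rw [hP, Matrix.fromBlocks_conjTranspose, hW.inv.isHermitian.eq]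
    simp
  have h1 := hG.posSemidef.mul_mul_conjTranspose_same (G⁻¹ - P)
  rw [Matrix.conjTranspose_sub, hPh, hG.inv.isHermitian.eq] at h1
  have h2 : (Matrix.fromBlocks (W⁻¹ * (W - G.toBlocks₁₁) * W⁻¹) 0 0 0 :
      Matrix d.Idx d.Idx ℂ).PosSemidef := by
    have := hsub.mul_mul_conjTranspose_same W⁻¹
    rw [hW.inv.isHermitian.eq] at this
    exact posSemidef_fromBlocks_zero this
  have h3 : (Matrix.fromBlocks (W⁻¹ * (W - G.toBlocks₁₁) * W⁻¹) 0 0 0 : Matrix d.Idx d.Idx ℂ)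
      = P - P * G * P := by
    conv_rhs => rw [← Matrix.fromBlocks_toBlocks G, hP, Matrix.fromBlocks_multiply,
      Matrix.fromBlocks_multiply, sub_eq_add_neg, Matrix.fromBlocks_neg, Matrix.fromBlocks_add]
    simp only [← sub_eq_add_neg, mul_sub, sub_mul, Matrix.nonsing_inv_mul W uW, Matrix.one_mul, Matrix.mul_zero,
      Matrix.zero_mul, add_zero, sub_zero]
  rw [h3] at h2
  convert h1.add h2 using 1
  simp only [sub_mul, mul_sub, Matrix.nonsing_inv_mul G uG, Matrix.one_mul]
  rw [Matrix.mul_assoc P G G⁻¹, Matrix.mul_nonsing_inv G uG, Matrix.mul_one]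
  abel

theorem infiniteObjective_le {p : Fin n → ℝ} (hp : ∀ i, 0 ≤ p i) {T : ℝ}
    (h : (gramian A p T).PosDef) :
    d.infiniteObjective p ≤ ((gramian A p T)⁻¹).trace := by
  rw [d.trace_inv_eq (isUnit_det_of_posDef h), infiniteObjective_eq]
  have h1 := ((d.posSemidef_inv_congruence_gramian_sub hp h).conjTranspose_mul_mul_same
    d.Qinv).trace_nonneg
  have h2 := (Complex.nonneg_iff.mp h1).1
  rw [Matrix.mul_sub, Matrix.sub_mul, Matrix.trace_sub, Complex.sub_re] at h2
  linarith

/-- Inserting the Lyapunov form of `G'` into `(G⁻¹)' = -G⁻¹ G' G⁻¹` gives a Riccati equation for the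
inverse. -/
theorem hasDerivAt_inv_congruence_gramian {p : Fin n → ℝ} {t : ℝ} (h : (gramian A p t).PosDef) :
    HasDerivAt (fun t => (d.congruence (gramian A p t))⁻¹)
      (-((d.congruence (gramian A p t))⁻¹ * d.jordanForm
        + d.jordanFormᴴ * (d.congruence (gramian A p t))⁻¹
        + (d.congruence (gramian A p t))⁻¹ * d.congruence (Matrix.diagonal p)
          * (d.congruence (gramian A p t))⁻¹)) t := by
  have hG := d.posDef_congruence h
  have uG := isUnit_det_of_posDef hG
  convert hasDerivAt_matrix_inv (d.hasDerivAt_congruence_gramian p t) hG.isUnit using 2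
  rw [congruence_gramianIntegrand]
  generalize d.congruence (gramian A p t) = G at *
  have a1 := Matrix.nonsing_inv_mul G uG
  have a2 := Matrix.mul_nonsing_inv G uG
  simp only [mul_add, add_mul]
  rw [← mul_assoc G⁻¹ d.jordanForm G, mul_assoc (G⁻¹ * d.jordanForm) G G⁻¹, a2, mul_one,
    ← mul_assoc G⁻¹ G, a1, one_mul]

/-- For a weight vector with positive entries, the inverse of the Gramian converges, in the
coordinates of the Jordan form, to `diag(W₋(p)⁻¹, 0)`. -/
theorem tendsto_inv_congruence_gramian {p : Fin n → ℝ} (hp : ∀ i, 0 < p i) :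
    Tendsto (fun T => (d.congruence (gramian A p T))⁻¹) atTop (𝓝 (d.stableInv p)) := by
  have hp0 : ∀ i, 0 ≤ p i := fun i => (hp i).le
  have hpd : ∀ t, 0 < t → (gramian A p t).PosDef := fun t ht => posDef_gramian hp ht
  set X := fun T => (d.congruence (gramian A p T))⁻¹ with hX
  -- The inverses decrease, so their negatives increase, with traces at most 0.
  obtain ⟨L, hL⟩ := exists_tendsto_of_posSemidef_sub (M := fun t => -X t) (c := 0)
    (fun s t hs hst => by
      have h := posSemidef_inv_sub_inv (d.posDef_congruence (hpd s hs))
        (d.posDef_congruence (hpd t (hs.trans_le hst))) (by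
          rw [← map_sub]
          exact d.posSemidef_congruence (posSemidef_gramian_sub hp0 hst))
      rw [neg_sub_neg]
      exact h)
    (fun t ht => by
      have h := (RCLike.nonneg_iff.mp
        (d.posDef_congruence (hpd t ht)).inv.posSemidef.trace_nonneg).1
      rw [Matrix.trace_neg, map_neg]
      exact neg_nonpos.mpr h)
  obtain ⟨Y, hY⟩ : ∃ Y, Tendsto X atTop (𝓝 Y) := ⟨-L, by simpa using hL.neg⟩
  -- The derivative is polynomial in `X`, so it converges too, and its limit is 0: `Y` solves the
  -- algebraic Riccati equation.
  have hric := eq_zero_of_tendsto_of_tendsto_deriv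
    (fun t ht => d.hasDerivAt_inv_congruence_gramian (hpd t ht)) hY
    (((hY.mul tendsto_const_nhds).add (tendsto_const_nhds.mul hY)).add
      ((hY.mul tendsto_const_nhds).mul hY)).neg
  rw [neg_eq_zero] at hric
  have hYsub : (Y - d.stableInv p).PosSemidef := by
    refine isClosed_posSemidef.mem_of_tendsto (hY.sub_const (d.stableInv p)) ?_
    filter_upwards [eventually_gt_atTop 0] with t ht
    exact d.posSemidef_inv_congruence_gramian_sub hp0 (hpd t ht)
  have hYpos : Y.PosSemidef := by
    refine isClosed_posSemidef.mem_of_tendsto hY ?_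
    filter_upwards [eventually_gt_atTop 0] with t ht
    exact (d.posDef_congruence (hpd t ht)).inv.posSemidef
  -- Positivity of every `p i` enters here, to make the quadratic coefficient definite.
  have hzero := riccati_apply_inr_eq_zero d.eigOther_re hYpos
    (d.posDef_congruence (Matrix.PosDef.diagonal hp)) hric
  have hYblock : Y = Matrix.fromBlocks Y.toBlocks₁₁ 0 0 0 := by
    ext i j
    rcases j with j | j
    · rcases i with i | i
      · rfl
      · rw [← hYpos.isHermitian.apply, hzero]
        simp
    · rw [hzero]
      rcases i with i | i <;> rfl
  have hW := d.posDef_WStableVec hp0 (hpd 1 one_pos)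
  have hY11 : Y.toBlocks₁₁.PosDef := posDef_of_posSemidef_sub hW.inv (hYsub.submatrix Sum.inl)
  suffices h : d.WStableVec p = Y.toBlocks₁₁⁻¹ by
    rw [stableInv, h, Matrix.nonsing_inv_nonsing_inv _ (isUnit_det_of_posDef hY11), ← hYblock]
    exact hY
  apply d.WStableVec_unique
  -- Multiplying the stable block of the Riccati equation by `Z⁻¹` on both sides turns it into the
  -- Lyapunov equation for `Z⁻¹`.
  have h11 : Y.toBlocks₁₁ * d.JStable + d.JStableᴴ * Y.toBlocks₁₁
      + Y.toBlocks₁₁ * (d.congruence (Matrix.diagonal p)).toBlocks₁₁ * Y.toBlocks₁₁ = 0 := by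
    have h := congrArg Matrix.toBlocks₁₁ hric
    rw [hYblock, ← Matrix.fromBlocks_toBlocks (d.congruence (Matrix.diagonal p)), jordanForm,
      Matrix.fromBlocks_conjTranspose, Matrix.fromBlocks_multiply, Matrix.fromBlocks_multiply,
      Matrix.fromBlocks_multiply, Matrix.fromBlocks_multiply, Matrix.fromBlocks_add,
      Matrix.fromBlocks_add, Matrix.toBlocks_fromBlocks₁₁] at h
    simpa using h.trans (show (0 : Matrix d.Idx d.Idx ℂ).toBlocks₁₁ = 0 from rfl)
  generalize Y.toBlocks₁₁ = Z at *
  have uZ := isUnit_det_of_posDef hY11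
  have a1 := Matrix.nonsing_inv_mul Z uZ
  have a2 := Matrix.mul_nonsing_inv Z uZ
  have h := congrArg (fun N => Z⁻¹ * N * Z⁻¹) h11
  simp only [mul_add, add_mul, mul_zero, zero_mul] at h
  rw [← mul_assoc Z⁻¹ Z, a1, one_mul, mul_assoc Z⁻¹ _ Z⁻¹, mul_assoc d.JStableᴴ Z Z⁻¹, a2, mul_one,
    mul_assoc Z⁻¹ _ Z⁻¹, mul_assoc _ Z Z⁻¹, a2, mul_one, ← mul_assoc Z⁻¹ Z, a1, one_mul] at h
  exact h

theorem tendsto_trace_inv_gramian {p : Fin n → ℝ} (hp : ∀ i, 0 < p i) :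
    Tendsto (fun T => ((gramian A p T)⁻¹).trace) atTop (𝓝 (d.infiniteObjective p)) := by
  have hc : Continuous fun X : Matrix d.Idx d.Idx ℂ => (d.Qinvᴴ * X * d.Qinv).trace.re :=
    Complex.continuous_re.comp
      ((continuous_const.matrix_mul continuous_id).matrix_mul continuous_const).matrix_trace
  refine ((hc.tendsto _).comp (d.tendsto_inv_congruence_gramian hp)).congr' ?_
  filter_upwards [eventually_gt_atTop 0] with T hT
  exact (d.trace_inv_eq (isUnit_det_of_posDef (posDef_gramian hp hT))).symm

theorem continuousAt_infiniteObjective {p : Fin n → ℝ} (hp : (d.WStableVec p).PosDef) :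
    ContinuousAt d.infiniteObjective p := by
  have hc : Continuous fun X : Matrix (Σ i, Fin (d.sizeStable i)) (Σ i, Fin (d.sizeStable i)) ℂ =>
      (d.Qinvᴴ * (Matrix.fromBlocks X 0 0 0 : Matrix d.Idx d.Idx ℂ) * d.Qinv).trace.re :=
    Complex.continuous_re.comp
      ((continuous_const.matrix_mul (continuous_id.matrix_fromBlocks continuous_const
        continuous_const continuous_const)).matrix_mul continuous_const).matrix_trace
  exact hc.continuousAt.comp
    ((continuousAt_inv_of_isUnit (isUnit_det_of_posDef hp)).comp
      d.continuous_WStableVec.continuousAt)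

/-- The infinite-horizon objective can be approximated at weight vectors with positive entries. -/
theorem exists_pos_infiniteObjective_lt {p : Fin n → ℝ} (hp : p ∈ d.infiniteFeasible) {ε : ℝ}
    (hε : 0 < ε) : ∃ q ∈ stdSimplex ℝ (Fin n), (∀ i, 0 < q i) ∧
      d.infiniteObjective q < d.infiniteObjective p + ε := by
  have hn : (0 : ℝ) < n := by
    rcases Nat.eq_zero_or_pos n with rfl | h
    · have := hp.1.2
      simp at this
    · exact_mod_cast h
  -- Mixing in a little of the uniform vector makes all weights positive; the objective is
  -- continuous at the feasible `p`.
  let q : ℝ → Fin n → ℝ := fun s i => (1 - s) * p i + s * (n : ℝ)⁻¹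
  have hq : Continuous q := by fun_prop
  have hq0 : q 0 = p := by
    funext i
    simp [q]
  have ht : Tendsto (fun s => d.infiniteObjective (q s)) (𝓝[>] 0) (𝓝 (d.infiniteObjective p)) := by
    have h := (d.continuousAt_infiniteObjective hp.2).tendsto
    rw [← hq0] at h ⊢
    exact h.comp ((hq.tendsto 0).mono_left nhdsWithin_le_nhds)
  have h1 := ht.eventually_lt_const (lt_add_of_pos_right _ hε)
  obtain ⟨s, hs, hs0, hs1⟩ := (h1.and (Ioo_mem_nhdsGT one_pos)).exists
  have hpos : ∀ i, 0 < q s i := fun i => by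
    have := mul_nonneg (sub_pos.mpr hs1).le (hp.1.1 i)
    have := mul_pos hs0 (inv_pos.mpr hn)
    simp only [q]
    linarith
  refine ⟨q s, ⟨fun i => (hpos i).le, ?_⟩, hpos, hs⟩
  simp only [q, Finset.sum_add_distrib, ← Finset.mul_sum, hp.1.2]
  simp [hn.ne']

/-- A minimizing family of the infinite-horizon problem converges to the optimal solution if that
is unique. -/
theorem tendsto_of_tendsto_infiniteObjective {pInf : Fin n → ℝ} (hopt : d.IsInfiniteAECS pInf)
    (huniq : ∀ q : Fin n → ℝ, d.IsInfiniteAECS q → q = pInf) {l : Filter ℝ} {p : ℝ → Fin n → ℝ}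
    (hp : ∀ᶠ T in l, p T ∈ d.infiniteFeasible)
    (hlim : Tendsto (fun T => d.infiniteObjective (p T)) l (𝓝 (d.infiniteObjective pInf))) :
    Tendsto p l (𝓝 pInf) := by
  let Φ : (Fin n → ℝ) → Matrix (Fin n) (Fin n) ℂ := fun q => d.Qinvᴴ * d.stableInv q * d.Qinv
  let blk : Matrix (Fin n) (Fin n) ℂ →
      Matrix (Σ i, Fin (d.sizeStable i)) (Σ i, Fin (d.sizeStable i)) ℂ :=
    fun Z => (d.Qᴴ * Z * d.Q).toBlocks₁₁
  have hblk : Continuous blk :=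
    ((continuous_const.matrix_mul continuous_id).matrix_mul continuous_const).matrix_submatrix
      Sum.inl Sum.inl
  have hblkΦ : ∀ q, blk (Φ q) = (d.WStableVec q)⁻¹ := fun q => by
    simp only [blk, Φ, d.conj_conj, stableInv, Matrix.toBlocks_fromBlocks₁₁]
  -- A minimizing family could a priori approach weights with singular `W₋`. On this compact set the
  -- closed equation `W₋ * blk Z = 1` excludes that, and the last condition forces `Z = Φ q`.
  let S : Set ((Fin n → ℝ) × Matrix (Fin n) (Fin n) ℂ) :=
    (stdSimplex ℝ (Fin n) ×ˢ
      {Z | Z.PosSemidef ∧ RCLike.re Z.trace ≤ d.infiniteObjective pInf + 1}) ∩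
    ({z | d.WStableVec z.1 * blk z.2 = 1} ∩
      {z | z.2 = d.Qinvᴴ * (Matrix.fromBlocks (blk z.2) 0 0 0 : Matrix d.Idx d.Idx ℂ) * d.Qinv})
  have hblk2 : Continuous fun z : (Fin n → ℝ) × Matrix (Fin n) (Fin n) ℂ => blk z.2 :=
    hblk.comp continuous_snd
  have hS : IsCompact S :=
    ((isCompact_stdSimplex ℝ (Fin n)).prod (isCompact_posSemidef_trace_le _)).inter_right
      ((isClosed_eq ((d.continuous_WStableVec.comp continuous_fst).matrix_mul hblk2)
        continuous_const).inter
        (isClosed_eq continuous_snd ((continuous_const.matrix_mul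
          (hblk2.matrix_fromBlocks continuous_const continuous_const
            continuous_const)).matrix_mul continuous_const)))
  have hmem : ∀ᶠ T in l, (p T, Φ (p T)) ∈ S := by
    filter_upwards [hp, hlim.eventually_le_const (lt_add_one _)] with T hT hT1
    refine ⟨⟨hT.1, ?_, hT1⟩, ?_, ?_⟩
    · exact (posSemidef_fromBlocks_zero hT.2.inv.posSemidef).conjTranspose_mul_mul_same _
    · show d.WStableVec (p T) * blk (Φ (p T)) = 1
      rw [hblkΦ]
      exact Matrix.mul_nonsing_inv _ (isUnit_det_of_posDef hT.2)
    · show Φ (p T) = d.Qinvᴴ * (Matrix.fromBlocks (blk (Φ (p T))) 0 0 0) * d.Qinv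
      rw [hblkΦ]
      rfl
  have htr : Continuous fun z : (Fin n → ℝ) × Matrix (Fin n) (Fin n) ℂ => z.2.trace.re :=
    Complex.continuous_re.comp continuous_snd.matrix_trace
  have hlimz : Tendsto (fun T => (p T, Φ (p T))) l (𝓝 (pInf, Φ pInf)) := by
    refine hS.tendsto_nhds_of_unique_mapClusterPt hmem ?_
    rintro ⟨q, Z⟩ ⟨⟨hq, hZ, -⟩, hWZ, hZeq⟩ hcl
    simp only [Set.mem_ofPred_eq] at hWZ hZeq
    obtain ⟨-, hWq⟩ := posDef_of_mul_eq_one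
      ((hZ.conjTranspose_mul_mul_same d.Q).submatrix Sum.inl) hWZ
    have hinv : (d.WStableVec q)⁻¹ = blk Z := Matrix.inv_eq_right_inv hWZ
    have hZΦ : Z = Φ q := by
      rw [hZeq, ← hinv]
      rfl
    -- The objective is the trace of the second component, continuous on pairs, so a cluster point
    -- takes the limit value and is itself optimal.
    have hval : d.infiniteObjective q = d.infiniteObjective pInf := by
      have h1 := hcl.continuousAt_comp htr.continuousAt
      have h2 : Z.trace.re = d.infiniteObjective q := by
        rw [hZΦ]
        rfl
      rw [h2] at h1
      exact eq_of_nhds_neBot (h1.clusterPt.mono hlim)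
    have hqeq : q = pInf :=
      huniq q ⟨⟨hq, hWq⟩, fun r hr => hval.le.trans (hopt.2 r hr)⟩
    rw [hZΦ, hqeq]
  exact (continuous_fst.tendsto _).comp hlimz

/-- Below, finite feasibility implies infinite feasibility, so `pInf` is at least as good; above,
compare with a positive near-optimal `q`, where the finite objectives converge. -/
theorem tendsto_infiniteObjective_of_isFiniteAECS {pInf : Fin n → ℝ}
    (hopt : d.IsInfiniteAECS pInf) {p : ℝ → Fin n → ℝ}
    (hp : ∀ T, 0 < T → IsFiniteAECS A T (p T)) :
    Tendsto (fun T => d.infiniteObjective (p T)) atTop (𝓝 (d.infiniteObjective pInf)) := by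
  refine tendsto_order.mpr ⟨fun a ha => ?_, fun a ha => ?_⟩
  · filter_upwards [eventually_gt_atTop 0] with T hT
    obtain ⟨⟨hs, hpd⟩, -⟩ := hp T hT
    exact ha.trans_le (hopt.2 _ ⟨hs, d.posDef_WStableVec hs.1 hpd⟩)
  · obtain ⟨q, hq, hqpos, hlt⟩ := d.exists_pos_infiniteObjective_lt hopt.1 (sub_pos.mpr ha)
    rw [add_sub_cancel] at hlt
    filter_upwards [eventually_gt_atTop 0,
      (d.tendsto_trace_inv_gramian hqpos).eventually_lt_const hlt] with T hT hTlt
    obtain ⟨⟨hs, hpd⟩, hmin⟩ := hp T hT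
    exact (d.infiniteObjective_le hs.1 hpd).trans_lt
      ((hmin q ⟨hq, posDef_gramian hqpos hT⟩).trans_lt hTlt)

end JordanDecomposition

end ControllabilityScore

/-! ### Existence and convergence of the finite-horizon optima -/

theorem mainTheorem3 {n : ℕ} (A : Matrix (Fin n) (Fin n) ℝ)
    (hA : ∃ μ ∈ spectrum ℂ (A.map Complex.ofReal), μ.re < 0)
    (d : ControllabilityScore.JordanDecomposition A)
    (pInf : Fin n → ℝ) (hopt : d.IsInfiniteAECS pInf)
    (huniq : ∀ q : Fin n → ℝ, d.IsInfiniteAECS q → q = pInf) :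
    (∀ T : ℝ, 0 < T → ∃ p : Fin n → ℝ, ControllabilityScore.IsFiniteAECS A T p) ∧
      ∀ p : ℝ → Fin n → ℝ,
        (∀ T : ℝ, 0 < T → ControllabilityScore.IsFiniteAECS A T (p T)) →
          Tendsto p atTop (𝓝 pInf) := by
  -- For `n = 0` the simplex is empty, since the empty sum is not 1.
  have hn : 0 < n := by
    rcases Nat.eq_zero_or_pos n with rfl | h
    · have := hopt.1.1.2
      simp at this
    · exact h
  refine ⟨fun T hT => ControllabilityScore.exists_isFiniteAECS hn hT, fun p hp => ?_⟩
  refine d.tendsto_of_tendsto_infiniteObjective hopt huniq ?_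
    (d.tendsto_infiniteObjective_of_isFiniteAECS hopt hp)
  filter_upwards [eventually_gt_atTop 0] with T hT
  obtain ⟨⟨hs, hpd⟩, -⟩ := hp T hT
  exact ⟨hs, d.posDef_WStableVec hs.1 hpd⟩
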